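/- Let $P\ge 1$. For $\delta>0$, $M\ge 1$ and $\mu_1,\dots,\mu_P\ge 0$, let $\mathbf X_1,\dots,\mathbf X_M$ be independent and identically distributed $P$-dimensional random vectors, where each $\mathbf X_m=(X_{m,1},\dots,X_{m,P})^T$ has independent components $X_{m,i}\sim\delta\,\mathrm{Pois}(\mu_i)$ (that is, $X_{m,i}/\delta$ is Poisson with mean $\mu_i$). Let $\mathcal L(\mathbb X;\mu_1,\dots,\mu_P)=\prod_{m=1}^M\prod_{i=1}^P \Pr\left(\delta\,\mathrm{Pois}(\mu_i)=X_{m,i}\right)$ denote the likelihood of the data $\mathbb X=\{\mathbf X_m\}_{m=1}^M$, and let $R=-2\log r$, where $$r=\frac{\sup_{\mu_c>0}\mathcal L(\mathbb X;\mu_c,\dots,\mu_c)}{\sup_{\mu_1,\dots,\mu_P\ge 0,\ \sum_i\mu_i>0}\mathcal L(\mathbb X;\mu_1,\dots,\mu_P)}$$ is the likelihood ratio statistic for testing $H:\mu_1=\dots=\mu_P$. Then: 1. The distribution of $R$ depends only on the products $\mu_iM$, $1\le i\le P$: two such samples, with parameters $(\delta,M,\mu_1,\dots,\mu_P)$ and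 $(\delta',M',\mu_1',\dots,\mu_P')$ satisfying $\mu_iM=\mu_i'M'$ for all $i$, give statistics $R$ and $R'$ with the same distribution. 2. Let $\delta>0$ be fixed. If $\mu_1=\dots=\mu_P=\mu_c$, then $R\overset{d}{\to}\chi^2_{P-1}$ as $\mu_cM\to\infty$, however $M\ge1$ and $\mu_c$ vary (in particular for $M=1$ fixed and $\mu_c\to\infty$), where $\chi^2_0$ is the point mass at $0$. Consequently, if $0<\alpha<1$ and $c_\alpha$ satisfies $\chi^2_{P-1}\big((c_\alpha,\infty)\big)=\alpha$, then $\Pr(R>c_\alpha)\to\alpha$ as $\mu_cM\to\infty$, so the test that rejects $H$ when $R>c_\alpha$ has asymptotic level $\alpha$, even for a single realization ($M=1$). -/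

import Mathlib

open MeasureTheory ProbabilityTheory Filter Topology
open scoped NNReal

/-- The law `δ · Pois(μ)` on `ℝ`: the law of `δ * N` with `N` Poisson of mean `μ`. -/
noncomputable def scaledPoisson (δ : ℝ) (μ : ℝ≥0) : Measure ℝ :=
  (poissonMeasure μ).map (fun n : ℕ => δ * (n : ℝ))

/-- The likelihood `L(x; μ₁, …, μ_P)` of data `x = (x m i)`: the product over all observations
of the probability mass that `δ · Pois(μ i)` gives to the observed value `x m i`. -/
noncomputable def likelihood {M P : ℕ} (δ : ℝ) (x : Fin M → Fin P → ℝ) (μ : Fin P → ℝ≥0) : ℝ :=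
  ∏ m, ∏ i, (scaledPoisson δ (μ i)).real {x m i}

/-- The likelihood ratio `r`: the supremum of the likelihood over `μ₁ = ⋯ = μ_P = c > 0`, divided
by its supremum over all `(μ₁, …, μ_P)` with `μ i ≥ 0` and `∑ μ i > 0`.
Likelihoods lie in `[0, 1]`, so the real suprema are over bounded sets. -/
noncomputable def likelihoodRatio {M P : ℕ} (δ : ℝ) (x : Fin M → Fin P → ℝ) : ℝ :=
  (⨆ c : {c : ℝ≥0 // 0 < c}, likelihood δ x (fun _ => (c : ℝ≥0))) /
    (⨆ μ : {μ : Fin P → ℝ≥0 // 0 < ∑ i, μ i}, likelihood δ x (μ : Fin P → ℝ≥0))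

/-- The test statistic `R = -2 log r`. -/
noncomputable def lrtStat {M P : ℕ} (δ : ℝ) (x : Fin M → Fin P → ℝ) : ℝ :=
  -2 * Real.log (likelihoodRatio δ x)

/-- `X 0, …, X (M-1)` are independent `P`-dimensional random vectors, each with independent
components, the `i`-th one of law `δ · Pois(μ i)`. (The law of a vector is then the product of the
laws of its components, so that the vectors are identically distributed.) -/
structure IsScaledPoissonSample {Ω : Type*} [MeasurableSpace Ω] (ν : Measure Ω) {M P : ℕ}
    (δ : ℝ) (μ : Fin P → ℝ≥0) (X : Fin M → Ω → Fin P → ℝ) : Prop where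
  indep_vectors : iIndepFun X ν
  indep_components : ∀ m, iIndepFun (fun (i : Fin P) (ω : Ω) => X m ω i) ν
  law : ∀ m i, HasLaw (fun ω => X m ω i) (scaledPoisson δ (μ i)) ν

/-- The `χ²` distribution with `k` degrees of freedom: the law of `∑ i < k, Z i ^ 2` with
independent standard normal `Z i`. For `k = 0` this is the point mass at `0`. -/
noncomputable def chiSquared (k : ℕ) : Measure ℝ :=
  (Measure.pi (fun _ : Fin k => gaussianReal 0 1)).map (fun z => ∑ i, z i ^ 2)

instance chiSquared_isProbabilityMeasure (k : ℕ) : IsProbabilityMeasure (chiSquared k) :=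
  Measure.isProbabilityMeasure_map (Measurable.aemeasurable (by fun_prop))

/-!
The statistic `R` depends on the data only through the total counts `S i = ∑ m, X m i / δ`: it is
their G-statistic `2 ∑ S i log (S i / S̄)`, where `S̄` is their mean. The `S i` are independent and
Poisson of mean `μ i * M`, so that the law of `R` depends only on these products.

If all `S i` have the same mean `r`, then `R = 2 ∑ r φ (S i / r) - 2 P r φ (S̄ / r)` with
`φ x = x log x + 1 - x`. Since `φ (1 + u) = u² q (1 + u)` with `q` continuous and `q 1 = 1 / 2`,
this is a continuous function of the standardized counts `Z i = (S i - r) / √r` and of `1 / √r`,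
which at `1 / √r = 0` is `‖Z‖² - ⟪w, Z⟫²` for the unit vector `w` along the diagonal. As `r → ∞`,
`Z` converges in distribution to a standard Gaussian vector, by convergence of characteristic
functions, and removing the component along `w` leaves `P - 1` squared standard normals.
-/

open InformationTheory

/-! ### The statistic as a function of the total counts -/

/-- The G-statistic `2 ∑ i, s i * log (s i / E)` of the counts `s`, where `E` is their mean. The
logarithm is split, so that nothing is divided by `E = 0`. -/
noncomputable def gStat {ι : Type*} [Fintype ι] (s : ι → ℝ) : ℝ :=
  2 * (∑ i, s i * Real.log (s i) - (∑ i, s i) * Real.log ((∑ i, s i) / Fintype.card ι))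

@[fun_prop]
lemma measurable_gStat {ι : Type*} [Fintype ι] : Measurable (gStat (ι := ι)) := by
  unfold gStat
  fun_prop

lemma mul_log_div (x : ℝ) {c : ℝ} (hc : c ≠ 0) :
    x * Real.log (x / c) = x * Real.log x - x * Real.log c := by
  rcases eq_or_ne x 0 with rfl | hx
  · simp
  · rw [Real.log_div hx hc, mul_sub]

lemma gStat_eq_log_div {ι : Type*} [Fintype ι] (s : ι → ℝ) {c : ℝ} (hc : c ≠ 0) :
    gStat s = 2 * (∑ i, s i * Real.log (s i / c) -
      (∑ i, s i) * Real.log ((∑ i, s i) / Fintype.card ι / c)) := by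
  rcases isEmpty_or_nonempty ι with _ | _
  · simp [gStat]
  have hcard : (Fintype.card ι : ℝ) ≠ 0 := Nat.cast_ne_zero.2 Fintype.card_ne_zero
  rw [gStat, div_div, mul_log_div _ hcard, mul_log_div _ (mul_ne_zero hcard hc),
    Real.log_mul hcard hc]
  simp only [mul_log_div _ hc, Finset.sum_sub_distrib, ← Finset.sum_mul]
  ring

/-- The factor of the likelihood of `c` independent Poisson variables of mean `a` with total `n`
that depends on `a`. -/
noncomputable def poissonWeight (c : ℝ) (n : ℕ) (a : ℝ) : ℝ :=
  Real.exp (-(c * a)) * a ^ n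

lemma continuous_poissonWeight (c : ℝ) (n : ℕ) : Continuous (poissonWeight c n) := by
  unfold poissonWeight
  fun_prop

lemma poissonWeight_nonneg (c : ℝ) (n : ℕ) {a : ℝ} (ha : 0 ≤ a) : 0 ≤ poissonWeight c n a := by
  unfold poissonWeight
  positivity

lemma poissonWeight_le_poissonWeight_div {a c : ℝ} (ha : 0 ≤ a) (hc : 0 < c) (n : ℕ) :
    poissonWeight c n a ≤ poissonWeight c n (n / c) := by
  rw [poissonWeight, poissonWeight, mul_div_cancel₀ _ hc.ne']
  rcases n.eq_zero_or_pos with rfl | hn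
  · simp only [pow_zero, mul_one, Nat.cast_zero, neg_zero, Real.exp_zero]
    exact Real.exp_le_one_iff.2 (neg_nonpos.2 (by positivity))
  -- `x ≤ exp (x - 1)` at the ratio `x` of `a` and its optimal value `n / c`
  set x := c * a / n with hx
  have ha' : a = x * (n / c) := by rw [hx]; field_simp
  have hxn : x ^ n ≤ Real.exp (c * a - n) :=
    calc x ^ n ≤ Real.exp (x - 1) ^ n := by
          gcongr
          linarith [Real.add_one_le_exp (x - 1)]
      _ = Real.exp (c * a - n) := by
          rw [← Real.exp_nat_mul, hx]
          congr 1
          field_simp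
  calc Real.exp (-(c * a)) * a ^ n = Real.exp (-(c * a)) * x ^ n * (n / c) ^ n := by
        conv_lhs => rw [ha', mul_pow, ← ha', ← mul_assoc]
    _ ≤ Real.exp (-(c * a)) * Real.exp (c * a - n) * (n / c) ^ n := by gcongr
    _ = Real.exp (-n) * (n / c) ^ n := by
        rw [← Real.exp_add]
        congr 2
        ring

lemma poissonWeight_div_pos {c : ℝ} (hc : 0 < c) (n : ℕ) : 0 < poissonWeight c n (n / c) := by
  unfold poissonWeight
  rcases n.eq_zero_or_pos with rfl | hn
  · simp
  · positivity

lemma log_poissonWeight_div {c : ℝ} (hc : 0 < c) (n : ℕ) :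
    Real.log (poissonWeight c n (n / c)) = n * Real.log (n / c) - n := by
  have hpow : ((n : ℝ) / c) ^ n ≠ 0 := right_ne_zero_of_mul (poissonWeight_div_pos hc n).ne'
  rw [poissonWeight, Real.log_mul (Real.exp_ne_zero _) hpow, Real.log_exp, Real.log_pow,
    mul_div_cancel₀ _ hc.ne']
  ring

lemma iSup_subtype_eq_of_dense {X α : Type*} [TopologicalSpace X] [TopologicalSpace α]
    [ConditionallyCompleteLinearOrder α] [ClosedIicTopology α] {p : X → Prop}
    (hp : Dense {x | p x}) {f : X → α} (hf : Continuous f) {a : X} (ha : ∀ x, f x ≤ f a) :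
    ⨆ x : {x // p x}, f x = f a :=
  (hp.ciSup' hf).trans (IsGreatest.csSup_eq ⟨⟨a, rfl⟩, Set.forall_mem_range.2 ha⟩)

lemma dense_setOf_nnreal_pos : Dense {c : ℝ≥0 | 0 < c} :=
  dense_iff_closure_eq.2 ((closure_Ioi (0 : ℝ≥0)).trans (by ext; simp))

lemma dense_setOf_sum_nnreal_pos {ι : Type*} [Fintype ι] [Nonempty ι] :
    Dense {μ : ι → ℝ≥0 | 0 < ∑ i, μ i} := by
  have h : Dense (Set.univ.pi fun _ : ι => {c : ℝ≥0 | 0 < c}) :=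
    dense_pi _ fun _ _ => dense_setOf_nnreal_pos
  exact h.mono fun μ hμ =>
    Finset.sum_pos (f := μ) (fun i _ => Set.mem_univ_pi.1 hμ i) Finset.univ_nonempty

lemma scaledPoisson_real_singleton {δ : ℝ} (hδ : δ ≠ 0) (r : ℝ≥0) (n : ℕ) :
    (scaledPoisson δ r).real {δ * n} = Real.exp (-r) * r ^ n / n.factorial := by
  rw [scaledPoisson, map_measureReal_apply (by fun_prop) (measurableSet_singleton _),
    ← poissonMeasure_real_singleton]
  congr 1
  ext k
  simp [hδ]

section LikelihoodOfCounts

variable {M P : ℕ} {δ : ℝ}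

lemma likelihood_mul_natCast (hδ : δ ≠ 0) (n : Fin M → Fin P → ℕ) (μ : Fin P → ℝ≥0) :
    likelihood δ (fun m i => δ * n m i) μ =
      (∏ m, ∏ i, ((n m i).factorial : ℝ)⁻¹) * ∏ i, poissonWeight M (∑ m, n m i) (μ i) := by
  simp only [likelihood, scaledPoisson_real_singleton hδ, div_eq_mul_inv, Finset.prod_mul_distrib,
    poissonWeight]
  rw [mul_comm, Finset.prod_comm (f := fun _ i => Real.exp (-(μ i : ℝ))),
    Finset.prod_comm (f := fun m i => (μ i : ℝ) ^ n m i)]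
  congr 2
  · simp [← Real.exp_nat_mul]
  · simp [Finset.prod_pow_eq_pow_sum]

lemma likelihood_mul_natCast_const (hδ : δ ≠ 0) (n : Fin M → Fin P → ℕ) (c : ℝ≥0) :
    likelihood δ (fun m i => δ * n m i) (fun _ => c) =
      (∏ m, ∏ i, ((n m i).factorial : ℝ)⁻¹) * poissonWeight (M * P) (∑ i, ∑ m, n m i) c := by
  rw [likelihood_mul_natCast hδ]
  simp only [poissonWeight]
  rw [Finset.prod_mul_distrib, Finset.prod_pow_eq_pow_sum, ← Real.exp_sum]
  simp only [Finset.sum_const, Finset.card_univ, Fintype.card_fin, nsmul_eq_mul]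
  congr 3
  ring

lemma iSup_likelihood_mul_natCast (hM : 1 ≤ M) (hP : 1 ≤ P) (hδ : δ ≠ 0)
    (n : Fin M → Fin P → ℕ) :
    (⨆ μ : {μ : Fin P → ℝ≥0 // 0 < ∑ i, μ i}, likelihood δ (fun m i => δ * n m i) μ) =
      (∏ m, ∏ i, ((n m i).factorial : ℝ)⁻¹) *
        ∏ i, poissonWeight M (∑ m, n m i) ((∑ m, n m i : ℕ) / M) := by
  have hM' : (0 : ℝ) < M := by exact_mod_cast hM
  have : NeZero P := ⟨by omega⟩
  simp only [likelihood_mul_natCast hδ]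
  refine (iSup_subtype_eq_of_dense dense_setOf_sum_nnreal_pos
    (f := fun μ => (∏ m, ∏ i, ((n m i).factorial : ℝ)⁻¹) *
      ∏ i, poissonWeight M (∑ m, n m i) (μ i))
    (a := fun i => (∑ m, n m i : ℕ) / M) ?_ fun μ => ?_).trans ?_
  · have := fun i => continuous_poissonWeight M (∑ m, n m i)
    fun_prop
  · gcongr with i
    · exact fun i _ => poissonWeight_nonneg _ _ (μ i).2
    · exact poissonWeight_le_poissonWeight_div (μ i).2 hM' _
  · simp

lemma iSup_likelihood_mul_natCast_const (hM : 1 ≤ M) (hP : 1 ≤ P) (hδ : δ ≠ 0)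
    (n : Fin M → Fin P → ℕ) :
    (⨆ c : {c : ℝ≥0 // 0 < c}, likelihood δ (fun m i => δ * n m i) (fun _ => (c : ℝ≥0))) =
      (∏ m, ∏ i, ((n m i).factorial : ℝ)⁻¹) *
        poissonWeight (M * P) (∑ i, ∑ m, n m i) ((∑ i, ∑ m, n m i : ℕ) / (M * P)) := by
  have hMP : (0 : ℝ) < M * P := by exact_mod_cast Nat.mul_pos hM hP
  simp only [likelihood_mul_natCast_const hδ]
  refine (iSup_subtype_eq_of_dense dense_setOf_nnreal_pos
    (f := fun c => (∏ m, ∏ i, ((n m i).factorial : ℝ)⁻¹) *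
      poissonWeight (M * P) (∑ i, ∑ m, n m i) c)
    (a := (∑ i, ∑ m, n m i : ℕ) / (M * P)) ?_ fun c => ?_).trans ?_
  · have := continuous_poissonWeight (M * P) (∑ i, ∑ m, n m i)
    fun_prop
  · gcongr
    exact poissonWeight_le_poissonWeight_div c.2 hMP _
  · simp

lemma lrtStat_mul_natCast (hM : 1 ≤ M) (hP : 1 ≤ P) (hδ : δ ≠ 0) (n : Fin M → Fin P → ℕ) :
    lrtStat δ (fun m i => δ * n m i) = gStat fun i => ((∑ m, n m i : ℕ) : ℝ) := by
  have hM' : (0 : ℝ) < M := by exact_mod_cast hM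
  have hMP : (0 : ℝ) < M * P := by exact_mod_cast Nat.mul_pos hM hP
  have hfact : (∏ m, ∏ i, ((n m i).factorial : ℝ)⁻¹) ≠ 0 :=
    Finset.prod_ne_zero_iff.2 fun m _ => Finset.prod_ne_zero_iff.2 fun i _ => by positivity
  have hpos (i : Fin P) : poissonWeight M (∑ m, n m i) ((∑ m, n m i : ℕ) / M) ≠ 0 :=
    (poissonWeight_div_pos hM' _).ne'
  rw [lrtStat, likelihoodRatio, iSup_likelihood_mul_natCast hM hP hδ,
    iSup_likelihood_mul_natCast_const hM hP hδ, mul_div_mul_left _ _ hfact,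
    Real.log_div (poissonWeight_div_pos hMP _).ne' (Finset.prod_ne_zero_iff.2 fun i _ => hpos i),
    Real.log_prod fun i _ => hpos i, log_poissonWeight_div hMP,
    Finset.sum_congr rfl fun i _ => log_poissonWeight_div hM' _, Finset.sum_sub_distrib,
    gStat_eq_log_div _ hM'.ne', Fintype.card_fin, div_div, mul_comm (P : ℝ)]
  push_cast
  ring

end LikelihoodOfCounts

/-! ### The law of the total counts -/

lemma charFunDual_map_cast_poissonMeasure (r : ℝ≥0) (L : StrongDual ℝ ℝ) :
    charFunDual Po(ℝ, r) L = Complex.exp (r * (Complex.exp (L 1 * Complex.I) - 1)) := by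
  rw [← charFun_map_cast_poissonMeasure, charFun_eq_charFunDual_toDualMap]
  congr 1
  ext
  simp

lemma hasLaw_sum_pi_poisson {Ω ι κ : Type*} [MeasurableSpace Ω] [Fintype ι] [Fintype κ]
    {ν : Measure Ω} {r : κ → ι → ℝ≥0} {Y : κ → Ω → ι → ℝ} (hind : iIndepFun Y ν)
    (hY : ∀ m, HasLaw (Y m) (Measure.pi fun i => Po(ℝ, r m i)) ν) :
    HasLaw (fun ω => ∑ m, Y m ω) (Measure.pi fun i => Po(ℝ, ∑ m, r m i)) ν := by
  classical
  have := hind.isProbabilityMeasure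
  have hsum : AEMeasurable (fun ω => ∑ m, Y m ω) ν :=
    Finset.aemeasurable_fun_sum _ fun m _ => (hY m).aemeasurable
  have := Measure.isProbabilityMeasure_map hsum
  refine ⟨hsum, charFunDual_eq_pi_iff.1 fun L => ?_⟩
  rw [hind.charFunDual_map_fun_sum_eq_prod fun m => (hY m).aemeasurable]
  simp only [fun m => (hY m).map_eq, Finset.prod_apply, charFunDual_pi,
    charFunDual_map_cast_poissonMeasure, NNReal.coe_sum, Complex.ofReal_sum, Finset.sum_mul,
    Complex.exp_sum]
  exact Finset.prod_comm

lemma map_div_scaledPoisson {δ : ℝ} (hδ : δ ≠ 0) (r : ℝ≥0) :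
    (scaledPoisson δ r).map (· / δ) = Po(ℝ, r) := by
  rw [scaledPoisson, Measure.map_map (by fun_prop) (by fun_prop)]
  congr 1
  ext n
  exact mul_div_cancel_left₀ _ hδ

lemma ae_mem_range_scaledPoisson (δ : ℝ) (r : ℝ≥0) :
    ∀ᵐ x ∂scaledPoisson δ r, x ∈ Set.range fun n : ℕ => δ * n :=
  (ae_map_iff (by fun_prop) (Set.countable_range _).measurableSet).2 (ae_of_all _ fun n => ⟨n, rfl⟩)

namespace IsScaledPoissonSample

variable {Ω : Type*} [MeasurableSpace Ω] {ν : Measure Ω} {M P : ℕ} {δ : ℝ} {μ : Fin P → ℝ≥0}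
  {X : Fin M → Ω → Fin P → ℝ}

lemma hasLaw_div (h : IsScaledPoissonSample ν δ μ X) (hδ : δ ≠ 0) (m : Fin M) :
    HasLaw (fun ω i => X m ω i / δ) (Measure.pi fun i => Po(ℝ, μ i)) ν := by
  have hdiv (i : Fin P) : HasLaw (· / δ) Po(ℝ, μ i) (scaledPoisson δ (μ i)) :=
    ⟨by fun_prop, map_div_scaledPoisson hδ (μ i)⟩
  exact ((h.indep_components m).comp (fun _ x => x / δ) fun _ => by fun_prop).hasLaw_pi
    fun i => (hdiv i).comp (h.law m i)

lemma hasLaw_sum_div (h : IsScaledPoissonSample ν δ μ X) (hδ : δ ≠ 0) :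
    HasLaw (fun ω => ∑ m, fun i => X m ω i / δ) (Measure.pi fun i => Po(ℝ, μ i * M)) ν := by
  have hind : iIndepFun (fun m ω i => X m ω i / δ) ν :=
    h.indep_vectors.comp (fun _ x i => x i / δ) fun _ => by fun_prop
  simpa [mul_comm] using hasLaw_sum_pi_poisson hind (h.hasLaw_div hδ)

lemma ae_mem_range (h : IsScaledPoissonSample ν δ μ X) :
    ∀ᵐ ω ∂ν, ∀ m i, X m ω i ∈ Set.range fun n : ℕ => δ * n :=
  ae_all_iff.2 fun m => ae_all_iff.2 fun i =>
    ae_of_ae_map (h.law m i).aemeasurable ((h.law m i).map_eq ▸ ae_mem_range_scaledPoisson δ (μ i))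

lemma lrtStat_ae_eq (h : IsScaledPoissonSample ν δ μ X) (hM : 1 ≤ M) (hP : 1 ≤ P) (hδ : δ ≠ 0) :
    (fun ω => lrtStat δ fun m => X m ω) =ᵐ[ν] fun ω => gStat (∑ m, fun i => X m ω i / δ) := by
  filter_upwards [h.ae_mem_range] with ω hω
  choose n hn using hω
  have hX : (fun m => X m ω) = fun m i => δ * n m i := by simp only [hn]
  have hsum : ∑ m, (fun i => X m ω i / δ) = fun i => ((∑ m, n m i : ℕ) : ℝ) := by
    ext i
    simp [← hn, hδ]
  rw [hX, lrtStat_mul_natCast hM hP hδ, hsum]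

lemma hasLaw_lrtStat (h : IsScaledPoissonSample ν δ μ X) (hM : 1 ≤ M) (hP : 1 ≤ P) (hδ : δ ≠ 0) :
    HasLaw (fun ω => lrtStat δ fun m => X m ω)
      ((Measure.pi fun i => Po(ℝ, μ i * M)).map gStat) ν :=
  (HasLaw.comp ⟨measurable_gStat.aemeasurable, rfl⟩ (h.hasLaw_sum_div hδ)).congr
    (h.lrtStat_ae_eq hM hP hδ)

end IsScaledPoissonSample

/-! ### The chi-squared distribution -/

lemma map_norm_sq_sub_inner_sq_stdGaussian {E : Type*} [NormedAddCommGroup E]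
    [InnerProductSpace ℝ E] [FiniteDimensional ℝ E] [MeasurableSpace E] [BorelSpace E] {k : ℕ}
    (hE : Module.finrank ℝ E = k + 1) {w : E} (hw : ‖w‖ = 1) :
    (stdGaussian E).map (fun v => ‖v‖ ^ 2 - inner ℝ w v ^ 2) = chiSquared k := by
  have horth : Orthonormal ℝ (({0} : Set (Fin (k + 1))).domRestrict fun _ => w) := by
    rw [orthonormal_iff_ite]
    rintro ⟨i, rfl⟩ ⟨j, rfl⟩
    simp [hw]
  obtain ⟨b, hb⟩ := horth.exists_orthonormalBasis_extension_of_card_eq (by simp [hE])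
  obtain rfl : b 0 = w := hb 0 rfl
  have hcoord : (fun v => ‖v‖ ^ 2 - inner ℝ (b 0) v ^ 2) ∘
      (fun x : Fin (k + 1) → ℝ => ∑ i, x i • b i) =
      (fun z : Fin k → ℝ => ∑ i, z i ^ 2) ∘ Prod.snd ∘
        MeasurableEquiv.piFinSuccAbove (fun _ => ℝ) 0 := by
    ext x
    have hinner (j : Fin (k + 1)) : inner ℝ (b j) (∑ i, x i • b i) = x j := by
      simp [inner_sum, inner_smul_right, b.inner_eq_ite]
    simp only [Function.comp_apply, ← b.sum_sq_inner_right, hinner]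
    rw [Fin.sum_univ_succ, add_sub_cancel_left]
    simp [MeasurableEquiv.piFinSuccAbove, Fin.tail]
  rw [stdGaussian_eq_map_pi_orthonormalBasis b, Measure.map_map (by fun_prop) (by fun_prop), hcoord,
    ← Measure.map_map (by fun_prop) (by fun_prop), ← Measure.map_map (by fun_prop) (by fun_prop),
    (measurePreserving_piFinSuccAbove (fun _ : Fin (k + 1) => gaussianReal 0 1) 0).map_eq,
    Measure.map_snd_prod]
  simp [chiSquared]

lemma map_sum_sq_sub_sq_sum_div_pi_gaussianReal (k : ℕ) :
    (Measure.pi fun _ : Fin (k + 1) => gaussianReal 0 1).map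
      (fun z => ∑ i, z i ^ 2 - (∑ i, z i) ^ 2 / ((k + 1 : ℕ) : ℝ)) = chiSquared k := by
  have hk : (0 : ℝ) < (k + 1 : ℕ) := by positivity
  set w : EuclideanSpace ℝ (Fin (k + 1)) := WithLp.toLp 2 fun _ => (√(k + 1 : ℕ))⁻¹ with hw_def
  have hw : ‖w‖ = 1 := by
    rw [EuclideanSpace.norm_eq, Real.sqrt_eq_one]
    simp [hw_def, Real.sq_sqrt hk.le, hk.ne', -Nat.cast_add]
  rw [← map_norm_sq_sub_inner_sq_stdGaussian (finrank_euclideanSpace_fin (𝕜 := ℝ)) hw,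
    ← map_pi_eq_stdGaussian, Measure.map_map (by fun_prop) (by fun_prop)]
  congr 1
  ext z
  simp only [Function.comp_apply, EuclideanSpace.real_norm_sq_eq, hw_def, PiLp.inner_apply,
    Real.inner_apply, ← Finset.mul_sum, mul_pow, inv_pow, Real.sq_sqrt hk.le]
  ring

lemma chiSquared_zero : chiSquared 0 = Measure.dirac 0 := by
  simp [chiSquared]

lemma chiSquared_succ (k : ℕ) :
    chiSquared (k + 1) = chiSquared k ∗ (gaussianReal 0 1).map (· ^ 2) := by
  rw [Measure.conv_comm, Measure.conv, chiSquared, chiSquared,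
    Measure.map_prod_map _ _ (by fun_prop) (by fun_prop),
    ← (measurePreserving_piFinSuccAbove (fun _ : Fin (k + 1) => gaussianReal 0 1) 0).map_eq,
    Measure.map_map (by fun_prop) (by fun_prop), Measure.map_map (by fun_prop) (by fun_prop)]
  congr 1
  ext z
  simp [MeasurableEquiv.piFinSuccAbove, Fin.tail, Fin.sum_univ_succ]

instance nullSingletonClass_conv {G : Type*} [AddGroup G] [MeasurableSpace G] [MeasurableAdd₂ G]
    [MeasurableSingletonClass G] (μ ρ : Measure G) [SFinite ρ] [NullSingletonClass ρ] :
    NullSingletonClass (μ ∗ ρ) where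
  measure_singleton c := by
    have hc : MeasurableSet ((fun p : G × G => p.1 + p.2) ⁻¹' {c}) :=
      measurable_add (measurableSet_singleton c)
    rw [Measure.conv, Measure.map_apply measurable_add (measurableSet_singleton c),
      Measure.measure_prod_null hc]
    refine ae_of_all _ fun x => ?_
    have hfiber : Prod.mk x ⁻¹' ((fun p : G × G => p.1 + p.2) ⁻¹' {c}) = {-x + c} := by
      ext y
      simp [eq_neg_add_iff_add_eq]
    simp [hfiber]

instance nullSingletonClass_map_sq_gaussianReal :
    NullSingletonClass ((gaussianReal 0 1).map (· ^ 2)) where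
  measure_singleton c := by
    have := nullSingletonClass_gaussianReal (μ := 0) (v := 1) one_ne_zero
    rw [Measure.map_apply (by fun_prop) (measurableSet_singleton c)]
    refine ((Set.toFinite {√c, -√c}).subset ?_).measure_zero _
    rintro x rfl
    rw [Real.sqrt_sq_eq_abs]
    exact (abs_eq (abs_nonneg x)).1 rfl

instance nullSingletonClass_chiSquared_succ (k : ℕ) : NullSingletonClass (chiSquared (k + 1)) :=
  chiSquared_succ k ▸ inferInstance

/-! ### The Poisson central limit theorem -/

/-- The standardization `(x - r) / √r` of a Poisson count `x`, whose mean and variance are `r`. -/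
noncomputable def poissonZScore (r x : ℝ) : ℝ :=
  (√r)⁻¹ * (x + -r)

@[fun_prop]
lemma measurable_poissonZScore (r : ℝ) : Measurable (poissonZScore r) := by
  unfold poissonZScore
  fun_prop

/-- The law of `(N - r) / √r` with `N` Poisson of mean `r`. -/
noncomputable def standardizedPoisson (r : ℝ≥0) : ProbabilityMeasure ℝ :=
  ⟨Po(ℝ, r).map (poissonZScore r), Measure.isProbabilityMeasure_map (by fun_prop)⟩

lemma charFun_standardizedPoisson (r : ℝ≥0) (t : ℝ) :
    charFun (standardizedPoisson r : Measure ℝ) t =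
      Complex.exp (r * (Complex.exp (((√r)⁻¹ * t : ℝ) * Complex.I) - 1 -
        ((√r)⁻¹ * t : ℝ) * Complex.I)) := by
  have hcomp : poissonZScore r = ((√r)⁻¹ * ·) ∘ (· + -(r : ℝ)) := rfl
  rw [standardizedPoisson, ProbabilityMeasure.coe_mk, hcomp,
    ← Measure.map_map (by fun_prop) (by fun_prop), charFun_map_mul, charFun_map_add_const,
    charFun_map_cast_poissonMeasure, ← Complex.exp_add]
  congr 1
  simp only [Real.inner_apply]
  push_cast
  ring

lemma tendsto_mul_exp_sub_one_sub {α : Type*} {l : Filter α} {c z : α → ℂ} {a : ℂ}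
    (hz : Tendsto z l (𝓝 0)) (hcz : Tendsto (fun x => c x * z x ^ 2) l (𝓝 a)) :
    Tendsto (fun x => c x * (Complex.exp (z x) - 1 - z x)) l (𝓝 (a / 2)) := by
  have hrem : (fun x => c x * (Complex.exp (z x) - ∑ i ∈ Finset.range 3, z x ^ i / i.factorial))
      =o[l] fun x => c x * z x ^ 2 :=
    (Asymptotics.isBigO_refl c l).mul_isLittleO
      ((Complex.exp_sub_sum_range_succ_isLittleO_pow 2).comp_tendsto hz)
  have hrem0 := (Asymptotics.isLittleO_one_iff ℂ).1 (hrem.trans_isBigO (hcz.isBigO_one ℂ))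
  refine (zero_add (a / 2) ▸ hrem0.add (hcz.div_const 2)).congr fun x => ?_
  simp only [Finset.sum_range_succ, Finset.sum_range_zero, Nat.factorial]
  push_cast
  ring

lemma tendsto_inv_sqrt_nnreal_atTop : Tendsto (fun r : ℝ≥0 => (√r)⁻¹) atTop (𝓝 0) :=
  tendsto_inv_atTop_zero.comp
    (Real.tendsto_sqrt_atTop.comp (NNReal.tendsto_coe_atTop.2 tendsto_id))

lemma tendsto_charFun_standardizedPoisson (t : ℝ) :
    Tendsto (fun r => charFun (standardizedPoisson r : Measure ℝ) t) atTop
      (𝓝 (charFun (gaussianReal 0 1) t)) := by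
  have hz : Tendsto (fun r : ℝ≥0 => (((√r)⁻¹ * t : ℝ) : ℂ) * Complex.I) atTop (𝓝 0) := by
    have hreal : Tendsto (fun r : ℝ≥0 => (√r)⁻¹ * t) atTop (𝓝 0) := by
      simpa using tendsto_inv_sqrt_nnreal_atTop.mul_const t
    simpa using ((Complex.continuous_ofReal.tendsto 0).comp hreal).mul_const Complex.I
  have hrz : Tendsto (fun r : ℝ≥0 => (r : ℂ) * ((((√r)⁻¹ * t : ℝ) : ℂ) * Complex.I) ^ 2) atTop
      (𝓝 (-(t : ℂ) ^ 2)) := by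
    refine tendsto_const_nhds.congr' ?_
    filter_upwards [eventually_gt_atTop 0] with r hr
    have hreal : (r : ℝ) * ((√r)⁻¹ * t) ^ 2 = t ^ 2 := by
      rw [mul_pow, inv_pow, Real.sq_sqrt r.coe_nonneg,
        mul_inv_cancel_left₀ (NNReal.coe_ne_zero.2 hr.ne')]
    rw [mul_pow, Complex.I_sq, mul_neg_one, mul_neg]
    exact_mod_cast congrArg Neg.neg hreal.symm
  have hexp := (Complex.continuous_exp.tendsto _).comp (tendsto_mul_exp_sub_one_sub hz hrz)
  rw [charFun_gaussianReal]
  simpa only [Function.comp_def, charFun_standardizedPoisson, Complex.ofReal_zero, mul_zero,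
    zero_mul, zero_sub, NNReal.coe_one, Complex.ofReal_one, one_mul, neg_div] using hexp

lemma tendsto_standardizedPoisson :
    Tendsto standardizedPoisson atTop (𝓝 ⟨gaussianReal 0 1, inferInstance⟩) :=
  tendsto_of_seq_tendsto fun _ hu => ProbabilityMeasure.tendsto_of_tendsto_charFun fun t =>
    (tendsto_charFun_standardizedPoisson t).comp hu

/-! ### Expansion of the G-statistic around a common mean -/

/-- The quotient `klFun x / (x - 1) ^ 2`, with its removable singularity at `1` filled in. -/
noncomputable def klQuotient : ℝ → ℝ :=
  Function.update (fun x => klFun x / (x - 1) ^ 2) 1 2⁻¹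

lemma klQuotient_one : klQuotient 1 = 2⁻¹ :=
  Function.update_self ..

lemma sq_mul_klQuotient (x : ℝ) : (x - 1) ^ 2 * klQuotient x = klFun x := by
  rcases eq_or_ne x 1 with rfl | hx
  · simp [klFun_one]
  · rw [klQuotient, Function.update_of_ne hx, mul_div_cancel₀ _ (pow_ne_zero 2 (sub_ne_zero.2 hx))]

lemma tendsto_log_div_sub_one : Tendsto (fun x => Real.log x / (x - 1)) (𝓝[≠] 1) (𝓝 1) := by
  have h := (Real.hasDerivAt_log one_ne_zero).tendsto_slope
  simp only [slope_fun_def_field, Real.log_one, sub_zero, inv_one] at h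
  exact h

lemma tendsto_klFun_div_sq : Tendsto (fun x => klFun x / (x - 1) ^ 2) (𝓝[≠] 1) (𝓝 2⁻¹) := by
  have hklFun : Tendsto klFun (𝓝[≠] 1) (𝓝 0) :=
    klFun_one ▸ (continuous_klFun.tendsto 1).mono_left nhdsWithin_le_nhds
  have hsq : Tendsto (fun x : ℝ => (x - 1) ^ 2) (𝓝[≠] 1) (𝓝 0) := by
    have hcont : Continuous fun x : ℝ => (x - 1) ^ 2 := by fun_prop
    simpa using (hcont.tendsto 1).mono_left nhdsWithin_le_nhds
  have hne : ∀ᶠ x : ℝ in 𝓝[≠] 1, x ≠ 0 := nhdsWithin_le_nhds (isOpen_ne.mem_nhds one_ne_zero)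
  refine HasDerivAt.lhopital_zero_nhdsNE (f' := Real.log) (g' := fun x => 2 * (x - 1))
    (hne.mono fun x => hasDerivAt_klFun)
    (Eventually.of_forall fun x => ?_) ?_ hklFun hsq ?_
  · simpa using ((hasDerivAt_id x).sub_const 1).fun_pow 2
  · filter_upwards [self_mem_nhdsWithin] with x hx
    exact mul_ne_zero two_ne_zero (sub_ne_zero.2 hx)
  · refine (mul_one (2⁻¹ : ℝ) ▸ tendsto_log_div_sub_one.const_mul 2⁻¹).congr fun x => ?_
    rw [← div_eq_inv_mul, div_div, mul_comm (x - 1)]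

lemma continuous_klQuotient : Continuous klQuotient := by
  refine continuous_iff_continuousAt.2 fun x => ?_
  rcases eq_or_ne x 1 with rfl | hx
  · exact continuousAt_update_same.2 tendsto_klFun_div_sq
  · exact (continuousAt_update_of_ne hx).2 <| continuous_klFun.continuousAt.div (by fun_prop)
      (pow_ne_zero 2 (sub_ne_zero.2 hx))

lemma mul_klFun_div (s : ℝ) {r : ℝ} (hr : r ≠ 0) :
    r * klFun (s / r) = s * Real.log (s / r) + r - s := by
  rw [klFun_apply]
  field_simp

lemma poissonZScore_sq_mul_klQuotient {r : ℝ} (hr : 0 < r) (s : ℝ) :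
    poissonZScore r s ^ 2 * klQuotient (1 + (√r)⁻¹ * poissonZScore r s) = r * klFun (s / r) := by
  have hratio : 1 + (√r)⁻¹ * poissonZScore r s = s / r := by
    rw [poissonZScore, ← mul_assoc, ← mul_inv, Real.mul_self_sqrt hr.le]
    field_simp
    ring
  have hsq : poissonZScore r s ^ 2 = r * (s / r - 1) ^ 2 := by
    rw [poissonZScore, mul_pow, inv_pow, Real.sq_sqrt hr.le]
    field_simp
    ring
  rw [hratio, hsq, mul_assoc, sq_mul_klQuotient]

section Expansion

variable {ι : Type*} [Fintype ι]

lemma gStat_eq_klFun (s : ι → ℝ) {r : ℝ} (hr : r ≠ 0) :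
    gStat s = 2 * (∑ i, r * klFun (s i / r) -
      Fintype.card ι * (r * klFun ((∑ i, s i) / Fintype.card ι / r))) := by
  rcases isEmpty_or_nonempty ι with _ | _
  · simp [gStat]
  have hcard : (Fintype.card ι : ℝ) ≠ 0 := Nat.cast_ne_zero.2 Fintype.card_ne_zero
  simp only [gStat_eq_log_div s hr, mul_klFun_div _ hr, Finset.sum_sub_distrib,
    Finset.sum_add_distrib, Finset.sum_const, Finset.card_univ, nsmul_eq_mul, mul_sub, mul_add,
    ← mul_assoc (Fintype.card ι : ℝ), mul_div_cancel₀ _ hcard]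
  ring

/-- The G-statistic in terms of the standardized counts `p.1` and of `p.2 = 1 / √r`, where `r` is
the mean used to standardize; at `p.2 = 0` it is the quadratic form of the limit. -/
noncomputable def standardizedGStat (p : (ι → ℝ) × ℝ) : ℝ :=
  2 * (∑ i, p.1 i ^ 2 * klQuotient (1 + p.2 * p.1 i) -
    Fintype.card ι * (((∑ i, p.1 i) / Fintype.card ι) ^ 2 *
      klQuotient (1 + p.2 * ((∑ i, p.1 i) / Fintype.card ι))))

@[fun_prop]
lemma continuous_standardizedGStat : Continuous (standardizedGStat (ι := ι)) := by
  have := continuous_klQuotient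
  unfold standardizedGStat
  fun_prop

lemma standardizedGStat_zero (z : ι → ℝ) :
    standardizedGStat (z, 0) = ∑ i, z i ^ 2 - (∑ i, z i) ^ 2 / Fintype.card ι := by
  simp only [standardizedGStat, zero_mul, add_zero, klQuotient_one, ← Finset.sum_mul]
  field_simp

lemma sum_poissonZScore_div_card [Nonempty ι] (r : ℝ) (s : ι → ℝ) :
    (∑ i, poissonZScore r (s i)) / Fintype.card ι =
      poissonZScore r ((∑ i, s i) / Fintype.card ι) := by
  simp only [poissonZScore, ← Finset.mul_sum, Finset.sum_add_distrib, Finset.sum_const,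
    Finset.card_univ, nsmul_eq_mul]
  field_simp

lemma standardizedGStat_poissonZScore {r : ℝ} (hr : 0 < r) (s : ι → ℝ) :
    standardizedGStat (fun i => poissonZScore r (s i), (√r)⁻¹) = gStat s := by
  rcases isEmpty_or_nonempty ι with _ | _
  · simp [standardizedGStat, gStat]
  simp only [standardizedGStat, sum_poissonZScore_div_card, poissonZScore_sq_mul_klQuotient hr,
    gStat_eq_klFun s hr.ne']

end Expansion

/-! ### Convergence to the chi-squared distribution -/

/-- The law of the G-statistic of `P` independent Poisson counts of common mean `r`, which is the
law of the likelihood ratio statistic under the null hypothesis when `r` is `μc * M`. -/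
noncomputable def nullLaw (P : ℕ) (r : ℝ≥0) : ProbabilityMeasure ℝ :=
  ⟨(Measure.pi fun _ : Fin P => Po(ℝ, r)).map gStat,
    Measure.isProbabilityMeasure_map measurable_gStat.aemeasurable⟩

lemma nullLaw_eq_map_standardizedGStat (P : ℕ) {r : ℝ≥0} (hr : 0 < r) :
    nullLaw P r = ((ProbabilityMeasure.pi fun _ : Fin P => standardizedPoisson r).prod
      (diracProba (√r)⁻¹)).map continuous_standardizedGStat.aemeasurable := by
  apply Subtype.ext
  change (Measure.pi fun _ => Po(ℝ, r)).map gStat =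
    ((Measure.pi fun _ => Po(ℝ, r).map (poissonZScore r)).prod (Measure.dirac (√r)⁻¹)).map
      standardizedGStat
  rw [Measure.prod_dirac, Measure.map_map (by fun_prop) (by fun_prop),
    ← Measure.pi_map_pi fun _ => (measurable_poissonZScore r).aemeasurable,
    Measure.map_map (by fun_prop) (by fun_prop)]
  congr 1
  ext s
  exact (standardizedGStat_poissonZScore (NNReal.coe_pos.2 hr) s).symm

lemma map_standardizedGStat_pi_gaussianReal_prod_dirac (k : ℕ) :
    ((Measure.pi fun _ : Fin (k + 1) => gaussianReal 0 1).prod (Measure.dirac 0)).map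
      standardizedGStat = chiSquared k := by
  rw [Measure.prod_dirac, Measure.map_map (by fun_prop) (by fun_prop),
    ← map_sum_sq_sub_sq_sum_div_pi_gaussianReal]
  congr 1
  ext z
  rw [Function.comp_apply, standardizedGStat_zero, Fintype.card_fin]

lemma tendsto_nullLaw (k : ℕ) :
    Tendsto (nullLaw (k + 1)) atTop (𝓝 ⟨chiSquared k, inferInstance⟩) := by
  have hpi : Tendsto (fun r => ProbabilityMeasure.pi fun _ : Fin (k + 1) => standardizedPoisson r)
      atTop (𝓝 (ProbabilityMeasure.pi fun _ => ⟨gaussianReal 0 1, inferInstance⟩)) :=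
    (ProbabilityMeasure.continuous_pi.tendsto _).comp
      (tendsto_pi_nhds.2 fun _ => tendsto_standardizedPoisson)
  have hdirac := (continuous_diracProba.tendsto (0 : ℝ)).comp tendsto_inv_sqrt_nnreal_atTop
  have hprod := (ProbabilityMeasure.continuous_prod.tendsto _).comp (hpi.prodMk_nhds hdirac)
  have hmap := ProbabilityMeasure.tendsto_map_of_tendsto_of_continuous _ _ hprod
    continuous_standardizedGStat
  have hlim : ((ProbabilityMeasure.pi fun _ : Fin (k + 1) =>
      (⟨gaussianReal 0 1, inferInstance⟩ : ProbabilityMeasure ℝ)).prod (diracProba 0)).map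
        continuous_standardizedGStat.aemeasurable = ⟨chiSquared k, inferInstance⟩ :=
    Subtype.ext (map_standardizedGStat_pi_gaussianReal_prod_dirac k)
  refine (hlim ▸ hmap).congr' ?_
  filter_upwards [eventually_gt_atTop 0] with r hr
  exact (nullLaw_eq_map_standardizedGStat (k + 1) hr).symm

lemma nullLaw_one (r : ℝ≥0) : (nullLaw 1 r : Measure ℝ) = chiSquared 0 := by
  have hzero : gStat (ι := Fin 1) = fun _ => 0 := by
    ext s
    simp [gStat]
  rw [nullLaw, ProbabilityMeasure.coe_mk, hzero, Measure.map_const, measure_univ, one_smul,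
    chiSquared_zero]

lemma tendsto_nullLaw_Ioi {P : ℕ} (hP : 1 ≤ P) (c : ℝ) :
    Tendsto (fun r => (nullLaw P r : Measure ℝ).real (Set.Ioi c)) atTop
      (𝓝 ((chiSquared (P - 1)).real (Set.Ioi c))) := by
  obtain ⟨k, rfl⟩ := Nat.exists_eq_add_of_le' hP
  rw [Nat.add_sub_cancel]
  cases k with
  | zero => simp [nullLaw_one]
  | succ n =>
    have hfrontier : chiSquared (n + 1) (frontier (Set.Ioi c)) = 0 := by
      rw [frontier_Ioi, measure_singleton]
    exact (ENNReal.tendsto_toReal (measure_ne_top _ _)).comp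
      (ProbabilityMeasure.tendsto_measure_of_null_frontier_of_tendsto' (tendsto_nullLaw (n + 1))
        hfrontier)

namespace IsScaledPoissonSample

lemma identDistrib_lrtStat {Ω Ω' : Type*} [MeasurableSpace Ω] [MeasurableSpace Ω']
    {ν : Measure Ω} {ν' : Measure Ω'} {M M' P : ℕ} {δ δ' : ℝ} {μ μ' : Fin P → ℝ≥0}
    {X : Fin M → Ω → Fin P → ℝ} {X' : Fin M' → Ω' → Fin P → ℝ}
    (hX : IsScaledPoissonSample ν δ μ X) (hX' : IsScaledPoissonSample ν' δ' μ' X')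
    (hP : 1 ≤ P) (hM : 1 ≤ M) (hM' : 1 ≤ M') (hδ : δ ≠ 0) (hδ' : δ' ≠ 0)
    (hμ : ∀ i, μ i * (M : ℝ≥0) = μ' i * (M' : ℝ≥0)) :
    IdentDistrib (fun ω => lrtStat δ fun m => X m ω) (fun ω => lrtStat δ' fun m => X' m ω) ν ν' :=
  (hX.hasLaw_lrtStat hM hP hδ).identDistrib
    (by simpa only [hμ] using hX'.hasLaw_lrtStat hM' hP hδ')

lemma hasLaw_lrtStat_nullLaw {Ω : Type*} [MeasurableSpace Ω] {ν : Measure Ω} {M P : ℕ} {δ : ℝ}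
    {μc : ℝ≥0} {X : Fin M → Ω → Fin P → ℝ} (hX : IsScaledPoissonSample ν δ (fun _ => μc) X)
    (hP : 1 ≤ P) (hM : 1 ≤ M) (hδ : δ ≠ 0) :
    HasLaw (fun ω => lrtStat δ fun m => X m ω) (nullLaw P (μc * M)) ν :=
  hX.hasLaw_lrtStat hM hP hδ

section Null

variable {P : ℕ} {ι : Type*} {l : Filter ι} {M : ι → ℕ} {δ : ι → ℝ} {μc : ι → ℝ≥0}
  {Ω : ι → Type*} [∀ j, MeasurableSpace (Ω j)] {ν : ∀ j, Measure (Ω j)}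
  {X : ∀ j, Fin (M j) → Ω j → Fin P → ℝ}

lemma tendstoInDistribution_lrtStat [∀ j, IsProbabilityMeasure (ν j)]
    (hX : ∀ j, IsScaledPoissonSample (ν j) (δ j) (fun _ => μc j) (X j))
    (hP : 1 ≤ P) (hM : ∀ j, 1 ≤ M j) (hδ : ∀ j, δ j ≠ 0)
    (hlim : Tendsto (fun j => μc j * (M j : ℝ≥0)) l atTop) :
    TendstoInDistribution (fun j ω => lrtStat (δ j) fun m => X j m ω) l (id : ℝ → ℝ) ν
      (chiSquared (P - 1)) := by
  obtain ⟨k, rfl⟩ := Nat.exists_eq_add_of_le' hP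
  have hlaw j := (hX j).hasLaw_lrtStat_nullLaw hP (hM j) (hδ j)
  have hid : (⟨chiSquared k, inferInstance⟩ : ProbabilityMeasure ℝ) =
      ⟨(chiSquared k).map id, Measure.isProbabilityMeasure_map aemeasurable_id⟩ :=
    Subtype.ext Measure.map_id.symm
  refine ⟨fun j => (hlaw j).aemeasurable, aemeasurable_id, ?_⟩
  exact (hid ▸ (tendsto_nullLaw k).comp hlim).congr fun j => Subtype.ext (hlaw j).map_eq.symm

lemma tendsto_measureReal_lt_lrtStat
    (hX : ∀ j, IsScaledPoissonSample (ν j) (δ j) (fun _ => μc j) (X j))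
    (hP : 1 ≤ P) (hM : ∀ j, 1 ≤ M j) (hδ : ∀ j, δ j ≠ 0)
    (hlim : Tendsto (fun j => μc j * (M j : ℝ≥0)) l atTop) (c : ℝ) :
    Tendsto (fun j => (ν j).real {ω | c < lrtStat (δ j) fun m => X j m ω}) l
      (𝓝 ((chiSquared (P - 1)).real (Set.Ioi c))) :=
  ((tendsto_nullLaw_Ioi hP c).comp hlim).congr fun j =>
    (((hX j).hasLaw_lrtStat_nullLaw hP (hM j) (hδ j)).measureReal_eq (p := (c < ·))
      measurableSet_Ioi).symm

end Null

end IsScaledPoissonSample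

theorem theorem3p1_general (P : ℕ) (hP : 1 ≤ P) :
    (∀ (δ δ' : ℝ), δ ≠ 0 → δ' ≠ 0 →
      ∀ (M M' : ℕ), 1 ≤ M → 1 ≤ M' →
      ∀ (μ μ' : Fin P → ℝ≥0), (∀ i, μ i * (M : ℝ≥0) = μ' i * (M' : ℝ≥0)) →
      ∀ (Ω Ω' : Type*) [MeasurableSpace Ω] [MeasurableSpace Ω']
        (ν : Measure Ω) (ν' : Measure Ω')
        (X : Fin M → Ω → Fin P → ℝ) (X' : Fin M' → Ω' → Fin P → ℝ),
        IsScaledPoissonSample ν δ μ X → IsScaledPoissonSample ν' δ' μ' X' →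
        IdentDistrib (fun ω => lrtStat δ (fun m => X m ω))
          (fun ω => lrtStat δ' (fun m => X' m ω)) ν ν') ∧
    (∀ (ι : Type*) (l : Filter ι) (δ : ι → ℝ) (M : ι → ℕ) (μc : ι → ℝ≥0), (∀ j, δ j ≠ 0) →
      (∀ j, 1 ≤ M j) → Tendsto (fun j => μc j * (M j : ℝ≥0)) l atTop →
      ∀ (Ω : ι → Type*) [∀ j, MeasurableSpace (Ω j)] (ν : ∀ j, Measure (Ω j))
        [∀ j, IsProbabilityMeasure (ν j)] (X : ∀ j, Fin (M j) → Ω j → Fin P → ℝ),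
        (∀ j, IsScaledPoissonSample (ν j) (δ j) (fun _ => μc j) (X j)) →
        TendstoInDistribution (fun j ω => lrtStat (δ j) (fun m => X j m ω)) l
          (id : ℝ → ℝ) ν (chiSquared (P - 1)) ∧
        ∀ c : ℝ, Tendsto (fun j => (ν j).real {ω | c < lrtStat (δ j) (fun m => X j m ω)}) l
          (𝓝 ((chiSquared (P - 1)).real (Set.Ioi c)))) := by
  constructor
  · intro δ δ' hδ hδ' M M' hM hM' μ μ' hμ Ω Ω' _ _ ν ν' X X' hX hX'
    exact hX.identDistrib_lrtStat hX' hP hM hM' hδ hδ' hμ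
  · intro ι l δ M μc hδ hM hlim Ω _ ν _ X hX
    exact ⟨IsScaledPoissonSample.tendstoInDistribution_lrtStat hX hP hM hδ hlim,
      IsScaledPoissonSample.tendsto_measureReal_lt_lrtStat hX hP hM hδ hlim⟩

theorem theorem3p1 (P : ℕ) (hP : 1 ≤ P) :
    -- the law of `R` depends only on the products `μ i * M`
    (∀ (δ δ' : ℝ), 0 < δ → 0 < δ' →
      ∀ (M M' : ℕ), 1 ≤ M → 1 ≤ M' →
      ∀ (μ μ' : Fin P → ℝ≥0), (∀ i, μ i * (M : ℝ≥0) = μ' i * (M' : ℝ≥0)) →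
      ∀ (Ω Ω' : Type*) [MeasurableSpace Ω] [MeasurableSpace Ω']
        (ν : Measure Ω) (ν' : Measure Ω') [IsProbabilityMeasure ν] [IsProbabilityMeasure ν']
        (X : Fin M → Ω → Fin P → ℝ) (X' : Fin M' → Ω' → Fin P → ℝ),
        IsScaledPoissonSample ν δ μ X → IsScaledPoissonSample ν' δ' μ' X' →
        IdentDistrib (fun ω => lrtStat δ (fun m => X m ω))
          (fun ω => lrtStat δ' (fun m => X' m ω)) ν ν') ∧
    -- under the null hypothesis, along any family of samples with `μc * M → ∞`
    -- (in particular with `M = 1` throughout)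
    (∀ (δ : ℝ), 0 < δ →
      ∀ (ι : Type*) (l : Filter ι) (M : ι → ℕ) (μc : ι → ℝ≥0), (∀ j, 1 ≤ M j) →
        Tendsto (fun j => μc j * (M j : ℝ≥0)) l atTop →
      ∀ (Ω : ι → Type*) [∀ j, MeasurableSpace (Ω j)] (ν : ∀ j, Measure (Ω j))
        [∀ j, IsProbabilityMeasure (ν j)] (X : ∀ j, Fin (M j) → Ω j → Fin P → ℝ),
        (∀ j, IsScaledPoissonSample (ν j) δ (fun _ => μc j) (X j)) →
        -- `R` converges in distribution to `χ²` with `P - 1` degrees of freedom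
        TendstoInDistribution (fun j ω => lrtStat δ (fun m => X j m ω)) l
          (id : ℝ → ℝ) ν (chiSquared (P - 1)) ∧
        -- and the test that rejects when `R` exceeds the upper `α` point of `χ²` has
        -- asymptotic level `α`
        (∀ (α c : ℝ), 0 < α → α < 1 → (chiSquared (P - 1)).real (Set.Ioi c) = α →
          Tendsto (fun j => (ν j).real {ω | c < lrtStat δ (fun m => X j m ω)}) l (𝓝 α))) := by
  obtain ⟨hident, hnull⟩ := theorem3p1_general P hP
  refine ⟨fun δ δ' hδ hδ' M M' hM hM' μ μ' hμ Ω Ω' _ _ ν ν' _ _ =>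
      hident δ δ' hδ.ne' hδ'.ne' M M' hM hM' μ μ' hμ Ω Ω' ν ν',
    fun δ hδ ι l M μc hM hlim Ω _ ν _ X hX => ?_⟩
  obtain ⟨hdist, htail⟩ := hnull ι l (fun _ => δ) M μc (fun _ => hδ.ne') hM hlim Ω ν X hX
  exact ⟨hdist, fun α c _ _ hc => hc ▸ htail c⟩
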